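/- Let $n=k^2$ be a perfect square and let $\mathcal D=(\mathbb R/\mathbb Z)^2$ be the unit square with wrap-around, with its Euclidean (flat torus) distance. Place $n$ servers at the points of the $\sqrt n\times\sqrt n$ square grid $\{(a/k,b/k): 0\le a,b<k\}$ of $\mathcal D$, and place $n$ users independently and uniformly at random on $\mathcal D$. The users are allocated to servers one after another by the spatial power of two policy (sPOT): each user goes to whichever of its two nearest servers has the smaller load at that moment, that is, has so far received fewer users. The order in which the users are served is arbitrary (it may be random and depend on the positions), and ties of loads or of distances are broken in an arbitrary way. The load of a server is the total number of users allocated to it. Then there are absolute constants $c>0$, $\delta>0$ and $n_0$ such that for every perfect square $n\ge n_0$, $$\Pr\Big[\max_{s} \mathrm{load}(s)\ \ge\ c\,\frac{\log n}{\log\log n}\Big]\ \ge\ 1-\frac1{n^{\delta}},$$ where the maximum is over all servers $s$. -/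

import Mathlib

open MeasureTheory ProbabilityTheory

/-- The unit square with wrap-around: the flat two-dimensional torus `(ℝ/ℤ)²`. Its `volume` is the
uniform probability distribution (area). -/
abbrev Torus : Type := UnitAddCircle × UnitAddCircle

/-- Euclidean distance on the torus. The norm of `UnitAddCircle` is the wrap-around distance to `0`,
so this is the least Euclidean distance between representatives of `p` and `q` in the plane. -/
noncomputable def torusDist (p q : Torus) : ℝ :=
  Real.sqrt (‖p.1 - q.1‖ ^ 2 + ‖p.2 - q.2‖ ^ 2)

/-- The servers of the `k × k` grid. -/
abbrev Server (k : ℕ) : Type := Fin k × Fin k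

/-- The server `(a, b)` is located at the point `(a / k, b / k)` of the torus. -/
noncomputable def serverPos {k : ℕ} (s : Server k) : Torus :=
  ((((s.1 : ℕ) : ℝ) / (k : ℝ) : ℝ), (((s.2 : ℕ) : ℝ) / (k : ℝ) : ℝ))

/-- `s` and `t` are two nearest servers of the point `p` (in either order): they are distinct and
no other server is strictly closer to `p` than one of them. -/
def TwoNearest {k : ℕ} (p : Torus) (s t : Server k) : Prop :=
  s ≠ t ∧ ∀ u : Server k, u ≠ s → u ≠ t →
    torusDist p (serverPos s) ≤ torusDist p (serverPos u) ∧
    torusDist p (serverPos t) ≤ torusDist p (serverPos u)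

/-- The load of the server `s` under the allocation `π`: the number of users allocated to `s`. -/
def load {k m : ℕ} (π : Fin m → Server k) (s : Server k) : ℕ :=
  (Finset.univ.filter fun j => π j = s).card

/-- The maximum load over all servers. -/
def maxLoad {k m : ℕ} (π : Fin m → Server k) : ℕ :=
  Finset.univ.sup (load π)

/-- The load of `s` at the moment when user `i` is allocated: only the users served before `i`
count. User `j` is served in round `order j`. -/
def loadBefore {k m : ℕ} (order : Equiv.Perm (Fin m)) (π : Fin m → Server k)
    (i : Fin m) (s : Server k) : ℕ :=
  (Finset.univ.filter fun j => order j < order i ∧ π j = s).card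

/-- `π` is a possible outcome of the spatial power of two policy for users at the points `x`, served
one after another in the given order: each user goes to one of its two nearest servers whose
current load is at most that of the other one. Ties (of loads and of distances) may be broken in any
way. -/
def IsSPOT {k m : ℕ} (order : Equiv.Perm (Fin m)) (x : Fin m → Torus)
    (π : Fin m → Server k) : Prop :=
  ∀ i, ∃ t, TwoNearest (x i) (π i) t ∧
    loadBefore order π i (π i) ≤ loadBefore order π i t

/-! Around the midpoint of each horizontal grid edge lies a small square of area `q = 1 / (16 n)`
whose points have the two ends of that edge as their two nearest servers. If `M` users fall in one
square, then one end receives at least `M / 2` of them, however users choose between the two ends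
(`le_two_mul_maxLoad`). The allocation thus reduces to throwing `n` independent points at `n`
disjoint squares. With `M` about `log n / (4 log log n)`, some square receives exactly `M` users
with high probability, by the second moment method applied to the pairs (square, set of `M` users):
the expected number of successful pairs is at least of order `√n`, and different squares are almost
uncorrelated (`measureReal_forall_notMem_exactHits_le`). The failure probability is `O(n^(-1/2))`,
hence below `n^(-1/4)`. -/

/-! ### Second moment method. -/

theorem measureReal_forall_notMem_le {Ω ι : Type*} [MeasurableSpace Ω] [Fintype ι]
    (μ : Measure Ω) [IsProbabilityMeasure μ] (A : ι → Set Ω) (hA : ∀ i, MeasurableSet (A i))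
    (hpos : 0 < ∑ i, μ.real (A i)) :
    μ.real {ω | ∀ i, ω ∉ A i} ≤
      (∑ i, ∑ j, μ.real (A i ∩ A j)) / (∑ i, μ.real (A i)) ^ 2 - 1 := by
  set m := ∑ i, μ.real (A i) with hm
  let Z : Ω → ℝ := fun ω => ∑ i, (A i).indicator (fun _ => (1 : ℝ)) ω
  have hind : ∀ s : Set Ω, MeasurableSet s → Integrable (s.indicator fun _ => (1 : ℝ)) μ :=
    fun s hs => (integrable_const 1).indicator hs
  have hZ : Integrable Z μ := integrable_finsetSum _ fun i _ => hind _ (hA i)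
  have hZZ : ∀ ω, Z ω ^ 2 = ∑ i, ∑ j, (A i ∩ A j).indicator (fun _ => (1 : ℝ)) ω := by
    intro ω
    simp only [Z, sq, Finset.sum_mul_sum]
    refine Finset.sum_congr rfl fun i _ => Finset.sum_congr rfl fun j _ => ?_
    by_cases h1 : ω ∈ A i <;> by_cases h2 : ω ∈ A j <;> simp [h1, h2]
  have hint2 : ∀ i, Integrable
      (fun ω => ∑ j, (A i ∩ A j).indicator (fun _ => (1 : ℝ)) ω) μ :=
    fun i => integrable_finsetSum _ fun j _ => hind _ ((hA i).inter (hA j))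
  have hZ2 : Integrable (fun ω => Z ω ^ 2) μ := by
    simp only [hZZ]
    exact integrable_finsetSum _ fun i _ => hint2 i
  have hEZ : ∫ ω, Z ω ∂μ = m := by
    simp only [Z]
    rw [integral_finsetSum _ fun i _ => hind _ (hA i)]
    exact Finset.sum_congr rfl fun i _ => integral_indicator_one (hA i)
  have hEZ2 : ∫ ω, Z ω ^ 2 ∂μ = ∑ i, ∑ j, μ.real (A i ∩ A j) := by
    simp only [hZZ]
    rw [integral_finsetSum _ fun i _ => hint2 i]
    refine Finset.sum_congr rfl fun i _ => ?_
    rw [integral_finsetSum _ fun j _ => hind _ ((hA i).inter (hA j))]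
    exact Finset.sum_congr rfl fun j _ => integral_indicator_one ((hA i).inter (hA j))
  have hN : MeasurableSet {ω | ∀ i, ω ∉ A i} := by
    simp only [Set.ofPred_forall]
    exact MeasurableSet.iInter fun i => (hA i).compl
  set N := {ω | ∀ i, ω ∉ A i} with hNdef
  have hlin : Integrable (fun ω => m ^ 2 - 2 * m * Z ω) μ :=
    (integrable_const _).sub (hZ.const_mul _)
  have hEN : ∫ ω, N.indicator (fun _ => (1 : ℝ)) ω ∂μ = μ.real N := integral_indicator_one hN
  -- Chebyshev: on `N` the count `Z` vanishes, so the indicator of `N` times `m ^ 2` is at most `(m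
  -- - Z) ^ 2`.
  have hle : m ^ 2 * μ.real N ≤ ∫ ω, (m ^ 2 - 2 * m * Z ω + Z ω ^ 2) ∂μ := by
    rw [← hEN, ← integral_const_mul]
    refine integral_mono ((hind _ hN).const_mul _) (hlin.add hZ2) fun ω => ?_
    by_cases h : ω ∈ N
    · have : Z ω = 0 := Finset.sum_eq_zero fun i _ => Set.indicator_of_notMem (h i) _
      simp [this, h]
    · simp only [Set.indicator_of_notMem h, mul_zero]
      nlinarith [sq_nonneg (m - Z ω)]
  rw [integral_add hlin hZ2, integral_sub (integrable_const _) (hZ.const_mul _),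
    integral_const_mul, hEZ, hEZ2] at hle
  simp only [integral_const, probReal_univ, one_smul] at hle
  rw [le_sub_iff_add_le, le_div_iff₀ (by positivity)]
  nlinarith

/-- The event that the variables `X i` with `i ∈ S` take values in `R` and the others do not. -/
def exactHits {Ω α κ : Type*} (X : κ → Ω → α) (R : Set α) (S : Finset κ) : Set Ω :=
  {ω | ∀ i, X i ω ∈ R ↔ i ∈ S}

open Classical in
theorem exactHits_eq {Ω α κ : Type*} (X : κ → Ω → α) (R : Set α) (S : Finset κ) :
    exactHits X R S = ⋂ i, X i ⁻¹' (if i ∈ S then R else Rᶜ) := by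
  ext ω
  simp only [exactHits, Set.mem_ofPred_eq, Set.mem_iInter, Set.mem_preimage]
  refine forall_congr' fun i => ?_
  by_cases h : i ∈ S <;> simp [h]

/-! ### Occupancy of disjoint regions by independent points. -/

section Occupancy

variable {Ω α κ ι : Type*} [MeasurableSpace Ω] [MeasurableSpace α] [Fintype κ]
  {μ : Measure Ω} [IsProbabilityMeasure μ] {X : κ → Ω → α}

theorem measurableSet_exactHits (hX : ∀ i, Measurable (X i)) {R : Set α} (hR : MeasurableSet R)
    (S : Finset κ) : MeasurableSet (exactHits X R S) := by
  classical
  rw [exactHits_eq]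
  refine MeasurableSet.iInter fun i => hX i ?_
  split_ifs
  exacts [hR, hR.compl]

omit [IsProbabilityMeasure μ] in
theorem measureReal_iInter_preimage (hind : iIndepFun X μ) (B : κ → Set α)
    (hB : ∀ i, MeasurableSet (B i)) :
    μ.real (⋂ i, X i ⁻¹' B i) = ∏ i, μ.real (X i ⁻¹' B i) := by
  have := hind.measure_inter_preimage_eq_mul Finset.univ (sets := B) fun i _ => hB i
  simp only [Finset.mem_univ, Set.iInter_true] at this
  simp only [Measure.real, this, ENNReal.toReal_prod]

open Classical in
theorem prod_ite_mem_card (S : Finset κ) (a b : ℝ) :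
    ∏ i, (if i ∈ S then a else b) = a ^ S.card * b ^ (Fintype.card κ - S.card) := by
  rw [Finset.prod_ite, Finset.prod_const, Finset.prod_const]
  congr 2
  · simp
  · rw [Finset.filter_not, Finset.card_sdiff_of_subset (by simp)]
    simp

theorem measureReal_exactHits (hX : ∀ i, Measurable (X i)) (hind : iIndepFun X μ)
    {R : Set α} (hR : MeasurableSet R) {q : ℝ} (hq : ∀ i, μ.real (X i ⁻¹' R) = q)
    (S : Finset κ) :
    μ.real (exactHits X R S) = q ^ S.card * (1 - q) ^ (Fintype.card κ - S.card) := by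
  classical
  rw [exactHits_eq, measureReal_iInter_preimage hind _ fun i => by
    split_ifs
    exacts [hR, hR.compl], ← prod_ite_mem_card]
  refine Finset.prod_congr rfl fun i _ => ?_
  split_ifs
  · exact hq i
  · rw [Set.preimage_compl, measureReal_compl (hX i hR), hq, probReal_univ]

/-- Both sides factor over the indices, so compare one index at a time. In `S` and `T` the joint
factor is 0; in just one of them it is at most `q = q (1 - q) (1 - q)⁻¹`; in neither it is `1 - 2q ≤
(1 - q) ^ 2`. -/
theorem measureReal_exactHits_inter_le (hX : ∀ i, Measurable (X i)) (hind : iIndepFun X μ)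
    {R R' : Set α} (hR : MeasurableSet R) (hR' : MeasurableSet R') (hd : Disjoint R R') {q : ℝ}
    (hq1 : q < 1) (hq : ∀ i, μ.real (X i ⁻¹' R) = q) (hq' : ∀ i, μ.real (X i ⁻¹' R') = q)
    (S T : Finset κ) :
    μ.real (exactHits X R S ∩ exactHits X R' T) ≤
      μ.real (exactHits X R S) * μ.real (exactHits X R' T) *
        (((1 - q)⁻¹) ^ S.card * ((1 - q)⁻¹) ^ T.card) := by
  classical
  rw [measureReal_exactHits hX hind hR hq, measureReal_exactHits hX hind hR' hq',
    exactHits_eq, exactHits_eq, ← Set.iInter_inter_distrib]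
  simp only [← Set.preimage_inter]
  rw [measureReal_iInter_preimage hind _ fun i => by
    refine MeasurableSet.inter ?_ ?_ <;> split_ifs
    exacts [hR, hR.compl, hR', hR'.compl]]
  have h1 := prod_ite_mem_card S (1 - q)⁻¹ 1
  have h2 := prod_ite_mem_card T (1 - q)⁻¹ 1
  rw [one_pow, mul_one] at h1 h2
  rw [← h1, ← h2, ← prod_ite_mem_card, ← prod_ite_mem_card, ← Finset.prod_mul_distrib,
    ← Finset.prod_mul_distrib, ← Finset.prod_mul_distrib]
  refine Finset.prod_le_prod (fun i _ => measureReal_nonneg) fun i _ => ?_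
  have hq0 : 0 ≤ q := hq i ▸ measureReal_nonneg
  have hp : 0 < 1 - q := sub_pos.2 hq1
  by_cases hS : i ∈ S <;> by_cases hT : i ∈ T <;> simp only [hS, hT, if_true, if_false]
  · rw [hd.inter_eq]
    simp only [Set.preimage_empty, measureReal_empty]
    positivity
  · calc μ.real (X i ⁻¹' (R ∩ R'ᶜ)) ≤ μ.real (X i ⁻¹' R) :=
          measureReal_mono (Set.preimage_mono Set.inter_subset_left)
      _ = _ := by rw [hq]; field_simp
  · calc μ.real (X i ⁻¹' (Rᶜ ∩ R')) ≤ μ.real (X i ⁻¹' R') :=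
          measureReal_mono (Set.preimage_mono Set.inter_subset_right)
      _ = _ := by rw [hq']; field_simp
  · rw [← Set.compl_union, Set.preimage_compl, measureReal_compl (hX i (hR.union hR')),
      Set.preimage_union, measureReal_union (hd.preimage _) (hX i hR'), hq, hq', probReal_univ]
    nlinarith [sq_nonneg q]

/-- If `X` are independent and each of the disjoint sets `R s` is hit by each `X i` with probability
`q`, then it is unlikely that no `R s` is hit exactly `M` times. -/
theorem measureReal_forall_notMem_exactHits_le [Fintype ι] [Nonempty ι]
    (hX : ∀ i, Measurable (X i)) (hind : iIndepFun X μ) (R : ι → Set α)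
    (hR : ∀ s, MeasurableSet (R s)) (hd : Pairwise (Function.onFun Disjoint R)) {q : ℝ}
    (hq0 : 0 < q) (hq1 : q < 1) (hq : ∀ s i, μ.real (X i ⁻¹' R s) = q) {M : ℕ}
    (hM : M ≤ Fintype.card κ) :
    μ.real {ω | ∀ s, ∀ S : Finset κ, S.card = M → ω ∉ exactHits X (R s) S} ≤
      1 / (Fintype.card ι * (Fintype.card κ).choose M * (q ^ M * (1 - q) ^ (Fintype.card κ - M)))
        + (((1 - q)⁻¹) ^ (2 * M) - 1) := by
  classical
  set p := q ^ M * (1 - q) ^ (Fintype.card κ - M) with hp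
  set r := ((1 - q)⁻¹) ^ (2 * M) with hr
  set C := (Fintype.card κ).choose M with hC
  have hp0 : 0 < p := by have := sub_pos.2 hq1; positivity
  have hC0 : 0 < C := Nat.choose_pos hM
  have hr0 : 0 ≤ r := by have := sub_pos.2 hq1; positivity
  let A : ι × {S : Finset κ // S.card = M} → Set Ω := fun j => exactHits X (R j.1) j.2
  have hA : ∀ j, MeasurableSet (A j) := fun j => measurableSet_exactHits hX (hR j.1) _
  have hAp : ∀ j, μ.real (A j) = p := fun j => by
    rw [measureReal_exactHits hX hind (hR _) (hq _), j.2.2]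
  have hcard : Fintype.card {S : Finset κ // S.card = M} = C := Fintype.card_finset_len M
  have hsum : ∑ j, μ.real (A j) = Fintype.card ι * C * p := by
    simp [hAp, hcard]
  have hm : 0 < ∑ j, μ.real (A j) := by
    rw [hsum]
    positivity
  -- Asking for the exact set of hits makes distinct events of one region disjoint, so within a
  -- region only the diagonal contributes.
  have hpair : ∀ i j, μ.real (A i ∩ A j) ≤ (if i = j then p else 0) + p ^ 2 * r := by
    intro i j
    by_cases hs : i.1 = j.1
    · by_cases hij : i = j
      · subst hij
        rw [Set.inter_self, hAp, if_pos rfl]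
        exact le_add_of_nonneg_right (by positivity)
      · have : A i ∩ A j = ∅ := by
          refine Set.eq_empty_of_forall_notMem fun ω ⟨hi, hj⟩ => hij ?_
          refine Prod.ext hs (Subtype.ext (Finset.ext fun a => ?_))
          have h1 := hi a
          rw [hs] at h1
          exact h1.symm.trans (hj a)
        rw [this, measureReal_empty, if_neg hij]
        positivity
    · have hij : i ≠ j := fun h => hs (h ▸ rfl)
      have := measureReal_exactHits_inter_le hX hind (hR i.1) (hR j.1) (hd hs) hq1 (hq _) (hq _)
        (i.2 : Finset κ) (j.2 : Finset κ)
      rw [if_neg hij, zero_add]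
      refine this.trans_eq ?_
      change μ.real (A i) * μ.real (A j) * _ = _
      rw [hAp, hAp, i.2.2, j.2.2, ← pow_add, ← two_mul, sq]
  have hset : {ω | ∀ s, ∀ S : Finset κ, S.card = M → ω ∉ exactHits X (R s) S} =
      {ω | ∀ j, ω ∉ A j} := by
    ext ω
    simp [A, Prod.forall]
  rw [hset]
  refine (measureReal_forall_notMem_le μ A hA hm).trans ?_
  have h2 : ∑ i, ∑ j, μ.real (A i ∩ A j) ≤
      (∑ j, μ.real (A j)) + (∑ j, μ.real (A j)) ^ 2 * r := by
    calc ∑ i, ∑ j, μ.real (A i ∩ A j)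
        ≤ ∑ i, ∑ j, ((if i = j then p else 0) + p ^ 2 * r) :=
          Finset.sum_le_sum fun i _ => Finset.sum_le_sum fun j _ => hpair i j
      _ = _ := by
          rw [hsum]
          simp only [Finset.sum_add_distrib, Finset.sum_ite_eq, Finset.mem_univ, if_true,
            Finset.sum_const, Finset.card_univ, Fintype.card_prod, hcard, nsmul_eq_mul,
            Nat.cast_mul]
          ring
  rw [← hsum]
  have h3 := div_le_div_of_nonneg_right h2 (sq_nonneg (∑ j, μ.real (A j)))
  rw [add_div, mul_div_cancel_left₀ _ (pow_pos hm 2).ne',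
    show (∑ j, μ.real (A j)) / (∑ j, μ.real (A j)) ^ 2 = 1 / ∑ j, μ.real (A j) by field_simp] at h3
  linarith

end Occupancy

/-! ### Nearest servers on the torus grid. -/

section Geometry

variable {k : ℕ}

theorem UnitAddCircle.norm_coe_div_le (hk : 0 < k) (x : ℝ) (j : ℤ) :
    ‖((x / k : ℝ) : UnitAddCircle)‖ ≤ |x - j * k| / k := by
  have hk' : (0 : ℝ) < k := Nat.cast_pos.2 hk
  rw [UnitAddCircle.norm_eq]
  refine (round_le _ j).trans_eq ?_
  rw [← abs_of_pos hk', ← abs_div, abs_of_pos hk', sub_div, mul_div_cancel_right₀ _ hk'.ne']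

theorem UnitAddCircle.le_norm_coe_div (hk : 0 < k) {x r : ℝ} (h : ∀ j : ℤ, r ≤ |x - j * k|) :
    r / k ≤ ‖((x / k : ℝ) : UnitAddCircle)‖ := by
  have hk' : (0 : ℝ) < k := Nat.cast_pos.2 hk
  rw [UnitAddCircle.norm_eq, div_le_iff₀ hk']
  refine (h (round (x / k))).trans_eq ?_
  have h1 := abs_mul (x / k - round (x / k)) k
  rwa [sub_mul, div_mul_cancel₀ _ hk'.ne', abs_of_pos hk'] at h1

/-- The other endpoint of the horizontal edge of the torus grid that starts at `s`. -/
def nextServer (s : Server k) : Server k :=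
  (⟨(s.1 + 1) % k, Nat.mod_lt _ (Fin.pos s.1)⟩, s.2)

/-- A small square around the midpoint of the edge from `s` to `nextServer s`. -/
def edgeRegion (s : Server k) : Set Torus :=
  Metric.closedBall ((((s.1 : ℕ) + 1 / 2 : ℝ) / k : ℝ) : UnitAddCircle) (1 / 8 / k) ×ˢ
    Metric.closedBall ((((s.2 : ℕ) : ℝ) / k : ℝ) : UnitAddCircle) (1 / 8 / k)

theorem Fin.sub_sub_mul_ne_zero {a b : Fin k} (h : a ≠ b) (j : ℤ) :
    ((a : ℕ) : ℤ) - ((b : ℕ) : ℤ) - j * k ≠ 0 := by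
  intro h0
  have h1 : ((a : ℕ) : ℤ) = ((b : ℕ) : ℤ) + j * k := by linarith
  have h2 : ((a : ℕ) : ℤ) % k = ((b : ℕ) : ℤ) % k := by rw [h1, Int.add_mul_emod_self_right]
  norm_cast at h2
  rw [Nat.mod_eq_of_lt a.2, Nat.mod_eq_of_lt b.2] at h2
  exact h (Fin.ext h2)

theorem one_div_le_norm_sub_of_ne {a b : Fin k} (h : a ≠ b) :
    1 / (k : ℝ) ≤ ‖((((a : ℕ) - (b : ℕ) : ℝ) / k : ℝ) : UnitAddCircle)‖ := by
  refine UnitAddCircle.le_norm_coe_div (Fin.pos a) fun j => ?_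
  have := Int.one_le_abs (Fin.sub_sub_mul_ne_zero h j)
  exact_mod_cast this

/-- Modulo `k`, the difference `a - b` is an integer other than 0 and -1; adding `1/2` leaves
absolute value at least `3/2`. -/
theorem three_halves_div_le_norm_sub {a b : Fin k} (h : b ≠ a)
    (h' : (b : ℕ) ≠ (a + 1) % k) :
    3 / 2 / (k : ℝ) ≤
      ‖((((a : ℕ) + 1 / 2 - (b : ℕ) : ℝ) / k : ℝ) : UnitAddCircle)‖ := by
  refine UnitAddCircle.le_norm_coe_div (Fin.pos a) fun j => ?_
  have h0 := Fin.sub_sub_mul_ne_zero h.symm j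
  have h1 : ((a : ℕ) : ℤ) - ((b : ℕ) : ℤ) - j * k ≠ -1 := by
    intro h2
    have h3 : (((a : ℕ) + 1 : ℕ) : ℤ) = ((b : ℕ) : ℤ) + j * k := by push_cast; linarith
    have h4 : (((a : ℕ) + 1 : ℕ) : ℤ) % k = ((b : ℕ) : ℤ) % k := by
      rw [h3, Int.add_mul_emod_self_right]
    norm_cast at h4
    rw [Nat.mod_eq_of_lt b.2] at h4
    exact h' h4.symm
  have hz : ((a : ℕ) + 1 / 2 : ℝ) - ((b : ℕ) : ℝ) - j * k =
      ((((a : ℕ) : ℤ) - ((b : ℕ) : ℤ) - j * k : ℤ) : ℝ) + 1 / 2 := by push_cast; ring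
  rw [hz]
  generalize ((a : ℕ) : ℤ) - ((b : ℕ) : ℤ) - j * k = z at *
  rcases (by omega : 1 ≤ z ∨ z ≤ -2) with hz | hz
  · have : (1 : ℝ) ≤ z := by exact_mod_cast hz
    exact le_abs.2 (Or.inl (by linarith))
  · have : (z : ℝ) ≤ -2 := by exact_mod_cast hz
    exact le_abs.2 (Or.inr (by linarith))

theorem norm_sub_serverPos_fst_le {s t : Server k} {p : Torus} (hp : p ∈ edgeRegion s)
    (ht : t = s ∨ t = nextServer s) : ‖p.1 - (serverPos t).1‖ ≤ 5 * (1 / 8 / k) := by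
  have hk := Fin.pos s.1
  have h1 := hp.1
  rw [Metric.mem_closedBall, dist_eq_norm] at h1
  have h2 : ‖((((s.1 : ℕ) + 1 / 2 : ℝ) / k : ℝ) : UnitAddCircle) - (serverPos t).1‖ ≤
      1 / 2 / k := by
    rw [serverPos, ← AddCircle.coe_sub, ← sub_div]
    rcases ht with rfl | rfl
    · refine (UnitAddCircle.norm_coe_div_le hk _ 0).trans_eq ?_
      congr 1
      norm_num
    -- The integer shift is the quotient discarded by the reduction mod `k`, nonzero only where the
    -- edge wraps around.
    · refine (UnitAddCircle.norm_coe_div_le hk _ (((s.1 + 1 : ℕ) / k : ℕ) : ℤ)).trans_eq ?_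
      congr 1
      have h3 : (((s.1 + 1 : ℕ) % k : ℕ) : ℝ) + k * (((s.1 + 1 : ℕ) / k : ℕ) : ℝ) =
          (s.1 : ℕ) + 1 := by exact_mod_cast Nat.mod_add_div (s.1 + 1 : ℕ) k
      simp only [nextServer, Int.cast_natCast]
      rw [show ((s.1 : ℕ) + 1 / 2 : ℝ) - (((s.1 + 1 : ℕ) % k : ℕ) : ℝ) -
        (((s.1 + 1 : ℕ) / k : ℕ) : ℝ) * k = -(1 / 2) by linarith]
      norm_num
  calc _ ≤ _ := norm_sub_le_norm_sub_add_norm_sub _ _ _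
    _ ≤ 1 / 8 / k + 1 / 2 / k := add_le_add h1 h2
    _ = _ := by ring

/-- In units of `e = 1 / (8k)`, an end of the edge is within 5 horizontally and 1 vertically,
squared distance at most 26. Any other server is at least 11 away horizontally (same row) or 7
vertically (other row), and 121 and 49 exceed 26. -/
theorem torusDist_lt_of_mem_edgeRegion {s t u : Server k} {p : Torus} (hp : p ∈ edgeRegion s)
    (ht : t = s ∨ t = nextServer s) (hu : u ≠ s) (hu' : u ≠ nextServer s) :
    torusDist p (serverPos t) < torusDist p (serverPos u) := by
  have hk := Fin.pos s.1
  have hk' : (0 : ℝ) < k := Nat.cast_pos.2 hk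
  set e : ℝ := 1 / 8 / k with he
  have he0 : 0 < e := by positivity
  have h1 := norm_sub_serverPos_fst_le hp ht
  have hp1 := hp.1
  have hp2 := hp.2
  rw [Metric.mem_closedBall, dist_eq_norm] at hp1 hp2
  have h2 : ‖p.2 - (serverPos t).2‖ ≤ e := by
    have : (serverPos t).2 = (serverPos s).2 := by rcases ht with rfl | rfl <;> rfl
    rw [this]
    exact hp2
  have h3 : ‖p.1 - (serverPos t).1‖ ^ 2 ≤ (5 * e) ^ 2 := pow_le_pow_left₀ (norm_nonneg _) h1 2
  have h4 : ‖p.2 - (serverPos t).2‖ ^ 2 ≤ e ^ 2 := pow_le_pow_left₀ (norm_nonneg _) h2 2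
  refine Real.sqrt_lt_sqrt (by positivity) ?_
  by_cases hb : u.2 = s.2
  · have ha : u.1 ≠ s.1 := fun h => hu (Prod.ext h hb)
    have ha' : (u.1 : ℕ) ≠ (s.1 + 1) % k := fun h => hu' (Prod.ext (Fin.ext h) hb)
    have h5 := three_halves_div_le_norm_sub ha ha'
    have h6 : 11 * e ≤ ‖p.1 - (serverPos u).1‖ := by
      have h7 := norm_sub_le_norm_sub_add_norm_sub
        ((((s.1 : ℕ) + 1 / 2 : ℝ) / k : ℝ) : UnitAddCircle) p.1 (serverPos u).1
      rw [norm_sub_rev _ p.1] at h7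
      rw [sub_div, AddCircle.coe_sub] at h5
      have h8 := h5.trans h7
      have : 3 / 2 / (k : ℝ) = 12 * e := by rw [he]; ring
      linarith
    have h9 := pow_le_pow_left₀ (by positivity) h6 2
    nlinarith [sq_nonneg ‖p.2 - (serverPos u).2‖]
  · have h5 := one_div_le_norm_sub_of_ne (Ne.symm hb)
    have h6 : 7 * e ≤ ‖p.2 - (serverPos u).2‖ := by
      have h7 := norm_sub_le_norm_sub_add_norm_sub
        ((((s.2 : ℕ) : ℝ) / k : ℝ) : UnitAddCircle) p.2 (serverPos u).2
      rw [norm_sub_rev _ p.2] at h7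
      rw [sub_div, AddCircle.coe_sub] at h5
      have h8 := h5.trans h7
      have : 1 / (k : ℝ) = 8 * e := by rw [he]; ring
      linarith
    have h9 := pow_le_pow_left₀ (by positivity) h6 2
    nlinarith [sq_nonneg ‖p.1 - (serverPos u).1‖]

theorem nextServer_ne (hk : 2 ≤ k) (s : Server k) : nextServer s ≠ s := by
  intro h
  have h1 : (s.1 + 1 : ℕ) % k = s.1 := congrArg (fun t : Server k => (t.1 : ℕ)) h
  have h2 := s.1.2
  rcases Nat.lt_or_ge (s.1 + 1 : ℕ) k with h3 | h3
  · rw [Nat.mod_eq_of_lt h3] at h1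
    omega
  · rw [show (s.1 + 1 : ℕ) = k by omega, Nat.mod_self] at h1
    omega

/-- Otherwise both ends are strictly closer than `t`, so each must be the single remaining server
`u`; but the ends are distinct once `k ≥ 2`. -/
theorem TwoNearest.eq_or_eq_nextServer (hk : 2 ≤ k) {s t u : Server k} {p : Torus}
    (h : TwoNearest p t u) (hp : p ∈ edgeRegion s) : t = s ∨ t = nextServer s := by
  by_contra! ht
  have hlt : ∀ v, v = s ∨ v = nextServer s → v = u := fun v hv => by
    by_contra hvu
    have hvt : v ≠ t := by
      rintro rfl
      exact hv.elim ht.1 ht.2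
    exact (torusDist_lt_of_mem_edgeRegion hp hv ht.1 ht.2).not_ge (h.2 v hvt hvu).1
  exact nextServer_ne hk s ((hlt _ (Or.inr rfl)).trans (hlt _ (Or.inl rfl)).symm)

theorem pairwise_disjoint_edgeRegion :
    Pairwise (Function.onFun Disjoint (edgeRegion : Server k → Set Torus)) := by
  intro s t hst
  have hk' : (0 : ℝ) < k := Nat.cast_pos.2 (Fin.pos s.1)
  refine Set.disjoint_left.2 fun p hs ht => ?_
  obtain ⟨hs1, hs2⟩ := hs
  obtain ⟨ht1, ht2⟩ := ht
  have key : ∀ {x y z : UnitAddCircle}, z ∈ Metric.closedBall x (1 / 8 / k) →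
      z ∈ Metric.closedBall y (1 / 8 / k) → ‖x - y‖ < 1 / (k : ℝ) := by
    intro x y z hx hy
    rw [Metric.mem_closedBall] at hx hy
    rw [← dist_eq_norm]
    have h1 := dist_triangle_left x y z
    have h2 : 1 / 8 / (k : ℝ) + 1 / 8 / k < 1 / k := by
      rw [← add_div]
      gcongr
      norm_num
    linarith
  by_cases hb : s.2 = t.2
  · have ha : s.1 ≠ t.1 := fun h => hst (Prod.ext h hb)
    refine (key hs1 ht1).not_ge ?_
    rw [← AddCircle.coe_sub, ← sub_div, add_sub_add_right_eq_sub]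
    exact one_div_le_norm_sub_of_ne ha
  · refine (key hs2 ht2).not_ge ?_
    rw [← AddCircle.coe_sub, ← sub_div]
    exact one_div_le_norm_sub_of_ne hb

theorem measurableSet_edgeRegion (s : Server k) : MeasurableSet (edgeRegion s) :=
  Metric.isClosed_closedBall.measurableSet.prod Metric.isClosed_closedBall.measurableSet

theorem volume_edgeRegion (s : Server k) :
    volume (edgeRegion s) = ENNReal.ofReal (1 / (16 * (k : ℝ) ^ 2)) := by
  have hk : (1 : ℝ) ≤ k := Nat.one_le_cast.2 (Fin.pos s.1)
  have h : min (1 : ℝ) (2 * (1 / 8 / k)) = 1 / (4 * k) := by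
    rw [min_eq_right]
    · field_simp
      norm_num
    · rw [← mul_div_assoc, div_le_one (by positivity)]
      linarith
  rw [edgeRegion, Measure.volume_eq_prod, Measure.prod_prod, AddCircle.volume_closedBall,
    AddCircle.volume_closedBall, h, ← ENNReal.ofReal_mul (by positivity)]
  congr 1
  field_simp
  norm_num

theorem le_two_mul_maxLoad {m : ℕ} (hk : 2 ≤ k) {order : Equiv.Perm (Fin m)} {x : Fin m → Torus}
    {π : Fin m → Server k} (h : IsSPOT order x π) (s : Server k) (S : Finset (Fin m))
    (hS : ∀ i ∈ S, x i ∈ edgeRegion s) : S.card ≤ 2 * maxLoad π := by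
  have hsub : S ⊆ (Finset.univ.filter fun j => π j = s) ∪
      Finset.univ.filter fun j => π j = nextServer s := by
    intro i hi
    obtain ⟨t, ht, -⟩ := h i
    simpa using ht.eq_or_eq_nextServer hk (hS i hi)
  calc S.card ≤ load π s + load π (nextServer s) :=
        (Finset.card_le_card hsub).trans (Finset.card_union_le _ _)
    _ ≤ maxLoad π + maxLoad π :=
        add_le_add (Finset.le_sup (Finset.mem_univ _)) (Finset.le_sup (Finset.mem_univ _))
    _ = 2 * maxLoad π := (two_mul _).symm

end Geometry

/-! ### Choice of `M` and numerical estimates. -/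

-- The base 32 is what `(n / (2M)) * q = 1 / (32M)` requires. Since `32M ≤ log n` and `M ≤ log n /
-- (2 log log n)`, `M log (32M) ≤ (log n) / 2`.
open Filter in
theorem eventually_ceil_log_div_loglog_pow_le :
    ∀ᶠ n : ℕ in atTop, 1 ≤ ⌈Real.log n / Real.log (Real.log n) / 4⌉₊ ∧
      (32 * (⌈Real.log n / Real.log (Real.log n) / 4⌉₊ : ℝ)) ^
        ⌈Real.log n / Real.log (Real.log n) / 4⌉₊ ≤ √(n : ℝ) := by
  have hlog : Tendsto (fun n : ℕ => Real.log n) atTop atTop :=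
    Real.tendsto_log_atTop.comp tendsto_natCast_atTop_atTop
  have hsmall : ∀ᶠ y : ℝ in atTop, Real.log y ≤ 1 / 4 * y := by
    have h := Real.isLittleO_log_id_atTop.bound (show (0 : ℝ) < 1 / 4 by norm_num)
    filter_upwards [h, eventually_ge_atTop 0] with y hy hy0
    simp only [id, Real.norm_of_nonneg hy0] at hy
    exact (Real.le_norm_self _).trans hy
  filter_upwards [hlog.eventually hsmall, (Real.tendsto_log_atTop.comp hlog).eventually_ge_atTop 16,
    hlog.eventually_gt_atTop 0, eventually_gt_atTop 0] with n h1 h2 h3 h4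
  simp only [Function.comp_apply] at h2
  set l := Real.log n
  set ll := Real.log l with hll
  have hll0 : 0 < ll := by linarith
  set Y := l / ll with hY
  have hY4 : 4 ≤ Y := by
    rw [hY, le_div_iff₀ hll0]
    linarith
  set M := ⌈Y / 4⌉₊ with hM
  have hM0 : 0 < M := Nat.ceil_pos.2 (by linarith)
  have hM0' : (0 : ℝ) < M := Nat.cast_pos.2 hM0
  have hMY : (M : ℝ) ≤ Y / 2 := by
    have := Nat.ceil_lt_add_one (show 0 ≤ Y / 4 by linarith)
    linarith
  refine ⟨hM0, ?_⟩
  have h5 : 32 * (M : ℝ) ≤ l := by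
    have : Y ≤ l / 16 := div_le_div_of_nonneg_left h3.le (by norm_num) h2
    linarith
  have h6 : Real.log (32 * M) ≤ ll := Real.log_le_log (by positivity) h5
  rw [← Real.log_le_log_iff (by positivity) (Real.sqrt_pos.2 (Nat.cast_pos.2 h4)), Real.log_pow,
    Real.log_sqrt (Nat.cast_nonneg n)]
  calc (M : ℝ) * Real.log (32 * M) ≤ Y / 2 * ll :=
        mul_le_mul hMY h6 (Real.log_nonneg (by linarith [Nat.one_le_cast (α := ℝ).2 hM0]))
          (by linarith)
    _ = l / 2 := by rw [hY]; field_simp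

theorem div_two_mul_pow_le_choose {n M : ℕ} (hM : 1 ≤ M) (h : 2 * M ≤ n) :
    ((n : ℝ) / (2 * M)) ^ M ≤ n.choose M := by
  have hM0 : (0 : ℝ) < M := Nat.cast_pos.2 hM
  have h1 : (n + 1 - M) ^ M ≤ M ^ M * n.choose M := by
    refine (n.pow_sub_le_descFactorial M).trans ?_
    rw [Nat.descFactorial_eq_factorial_mul_choose]
    exact Nat.mul_le_mul_right _ (Nat.factorial_le_pow M)
  have h2 : ((n + 1 - M : ℕ) : ℝ) ^ M ≤ (M : ℝ) ^ M * n.choose M := by exact_mod_cast h1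
  have h3 : (n : ℝ) / 2 ≤ ((n + 1 - M : ℕ) : ℝ) := by
    rw [Nat.cast_sub (by omega)]
    have : 2 * (M : ℝ) ≤ n := by exact_mod_cast h
    push_cast
    linarith
  rw [← div_div, div_pow, div_le_iff₀ (by positivity), mul_comm]
  exact (pow_le_pow_left₀ (by positivity) h3 M).trans h2

/-- With `t = √n`, the expected count is at least `n * (1 / t) * (15 / 16)`, and `M ≤ t` keeps the
correlation error below `1 / (4t)`. The sum is under `2 / t`, which is at most `n^(-1/4)` as `n ≥
16`. -/
theorem occupancy_bound_le {n M : ℕ} (hn : 16 ≤ n) (hM : 1 ≤ M)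
    (h : (32 * (M : ℝ)) ^ M ≤ √(n : ℝ)) {q : ℝ} (hq : q = 1 / (16 * n)) :
    M ≤ n ∧ 1 / (n * n.choose M * (q ^ M * (1 - q) ^ (n - M))) + (((1 - q)⁻¹) ^ (2 * M) - 1) ≤
      1 / (n : ℝ) ^ (1 / 4 : ℝ) := by
  have hM0 : (0 : ℝ) < M := Nat.cast_pos.2 hM
  have hM1 : (1 : ℝ) ≤ M := Nat.one_le_cast.2 hM
  have hn' : (16 : ℝ) ≤ n := by exact_mod_cast hn
  set t := √(n : ℝ) with ht
  have htt : t * t = n := Real.mul_self_sqrt (by positivity)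
  have ht4 : 4 ≤ t := Real.le_sqrt_of_sq_le (by linarith)
  have hMt : (M : ℝ) ≤ t := by
    refine le_trans ?_ h
    calc (M : ℝ) ≤ 32 * M := by linarith
      _ ≤ (32 * M) ^ M := le_self_pow₀ (by linarith) (by omega)
  have h2M : 2 * M ≤ n := by
    have : 2 * (M : ℝ) ≤ n := by nlinarith
    exact_mod_cast this
  have hq0 : 0 < q := by rw [hq]; positivity
  have hnq : n * q = 1 / 16 := by rw [hq]; field_simp
  have hq1 : q ≤ 1 / 16 := by nlinarith
  have h1q : 0 < 1 - q := by linarith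
  refine ⟨by omega, ?_⟩
  have hbern : ∀ m : ℕ, 1 - m * q ≤ (1 - q) ^ m := fun m => by
    have := one_add_mul_le_pow (show (-2 : ℝ) ≤ -q by linarith) m
    rwa [mul_neg, ← sub_eq_add_neg, ← sub_eq_add_neg] at this
  have hA : 1 / t ≤ n.choose M * q ^ M := by
    calc 1 / t ≤ 1 / (32 * (M : ℝ)) ^ M := one_div_le_one_div_of_le (by positivity) h
      _ = ((n : ℝ) / (2 * M)) ^ M * q ^ M := by
        rw [← mul_pow, ← one_div_pow, hq]
        congr 1
        field_simp
        norm_num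
      _ ≤ _ := by
        gcongr
        exact div_two_mul_pow_le_choose hM h2M
  have hB : 15 / 16 ≤ (1 - q) ^ (n - M) := by
    have h3 := hbern n
    have h4 : (1 - q) ^ n ≤ (1 - q) ^ (n - M) :=
      pow_le_pow_of_le_one h1q.le (by linarith) (Nat.sub_le _ _)
    linarith
  have hC : 15 / 16 * t ≤ n * n.choose M * (q ^ M * (1 - q) ^ (n - M)) := by
    calc 15 / 16 * t = n * (1 / t * (15 / 16)) := by rw [← htt]; field_simp
      _ ≤ n * (n.choose M * q ^ M * (1 - q) ^ (n - M)) := by gcongr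
      _ = _ := by ring
  have hD : 1 - 1 / (8 * t) ≤ (1 - q) ^ (2 * M) := by
    refine le_trans ?_ (hbern (2 * M))
    have h5 : t * q = 1 / (16 * t) := by
      rw [hq, ← htt]
      field_simp
    have h6 : (M : ℝ) * q ≤ 1 / (16 * t) := h5 ▸ mul_le_mul_of_nonneg_right hMt hq0.le
    have h7 : 1 / (8 * t) = 2 * (1 / (16 * t)) := by
      field_simp
      norm_num
    push_cast
    linarith
  have ht8 : 1 / (8 * t) ≤ 1 / 32 := one_div_le_one_div_of_le (by norm_num) (by linarith)
  have hE : ((1 - q)⁻¹) ^ (2 * M) - 1 ≤ 1 / (4 * t) := by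
    have h8 : 1 / (8 * t) = 1 / (4 * t) / 2 := by
      field_simp
      norm_num
    have h9 : 0 < 1 / (4 * t) := by positivity
    rw [inv_pow, sub_le_iff_le_add, inv_le_iff_one_le_mul₀ (by positivity)]
    have h10 := mul_le_mul_of_nonneg_left hD (show 0 ≤ 1 / (4 * t) + 1 by positivity)
    nlinarith
  have hF : 1 / (n * n.choose M * (q ^ M * (1 - q) ^ (n - M))) ≤ 16 / 15 * (1 / t) := by
    refine (one_div_le_one_div_of_le (by positivity) hC).trans_eq ?_
    field_simp
  set u := (n : ℝ) ^ (1 / 4 : ℝ) with hu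
  have hu0 : 0 < u := by positivity
  have huu : u * u = t := by
    rw [hu, ht, Real.sqrt_eq_rpow, ← Real.rpow_add (by positivity)]
    norm_num
  have hu2 : 2 ≤ u := by nlinarith
  have hG : 2 * (1 / t) ≤ 1 / u := by
    rw [← huu, mul_one_div, div_le_div_iff₀ (by positivity) hu0]
    nlinarith
  have hI : 1 / (4 * t) = 1 / 4 * (1 / t) := by field_simp
  have hJ : 0 < 1 / t := by positivity
  linarith

/-! ### The main theorem. -/

theorem mainTheorem1 :
    ∃ c : ℝ, 0 < c ∧ ∃ δ : ℝ, 0 < δ ∧ ∃ n₀ : ℕ, ∀ n k : ℕ, n₀ ≤ n → n = k ^ 2 →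
      ∀ (Ω : Type*) [MeasurableSpace Ω] (μ : Measure Ω) [IsProbabilityMeasure μ]
        (X : Fin n → Ω → Torus),
        (∀ i, Measurable (X i)) →
        (∀ i, μ.map (X i) = (volume : Measure Torus)) →
        iIndepFun X μ →
        ∀ (order : Ω → Equiv.Perm (Fin n)) (π : Ω → Fin n → Server k),
          (∀ᵐ ω ∂μ, IsSPOT (order ω) (fun i => X i ω) (π ω)) →
          μ {ω | ¬ c * (Real.log n / Real.log (Real.log n)) ≤ (maxLoad (π ω) : ℝ)}
            ≤ ENNReal.ofReal (1 / (n : ℝ) ^ δ) := by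
  obtain ⟨n₀, hn₀⟩ := Filter.eventually_atTop.1 eventually_ceil_log_div_loglog_pow_le
  -- `1/8` is the `1/4` in `M`, halved because two servers share the users of a square.
  refine ⟨1 / 8, by norm_num, 1 / 4, by norm_num, max n₀ 16, ?_⟩
  intro n k hn hnk Ω _ μ _ X hX hmap hind order π hπ
  obtain ⟨hM1, hMpow⟩ := hn₀ n (le_of_max_le_left hn)
  have hn16 : 16 ≤ n := le_of_max_le_right hn
  have hk : 2 ≤ k := by
    by_contra! hk
    interval_cases k <;> omega
  set M := ⌈Real.log n / Real.log (Real.log n) / 4⌉₊ with hM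
  obtain ⟨hMn, hbound⟩ := occupancy_bound_le hn16 hM1 hMpow rfl
  have hn' : (16 : ℝ) ≤ n := by exact_mod_cast hn16
  set q : ℝ := 1 / (16 * n) with hq
  have hq1 : q < 1 := by
    rw [hq, div_lt_one (by positivity)]
    linarith
  have hhit : ∀ (s : Server k) (i : Fin n), μ.real (X i ⁻¹' edgeRegion s) = q := by
    intro s i
    rw [Measure.real, ← Measure.map_apply (hX i) (measurableSet_edgeRegion s), hmap,
      volume_edgeRegion, ENNReal.toReal_ofReal (by positivity), hq, hnk, Nat.cast_pow]
  have : Nonempty (Server k) := ⟨(⟨0, by omega⟩, ⟨0, by omega⟩)⟩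
  have hmain := measureReal_forall_notMem_exactHits_le (M := M) hX hind edgeRegion
    measurableSet_edgeRegion pairwise_disjoint_edgeRegion (by positivity) hq1 hhit
    (by simpa using hMn)
  have hcard : Fintype.card (Server k) = n := by simp [hnk, sq]
  rw [hcard, Fintype.card_fin] at hmain
  calc μ {ω | ¬ 1 / 8 * (Real.log n / Real.log (Real.log n)) ≤ (maxLoad (π ω) : ℝ)}
      ≤ μ {ω | ∀ s, ∀ S : Finset (Fin n), S.card = M → ω ∉ exactHits X (edgeRegion s) S} := by
        -- The allocation need not be measurable; its bad event is enclosed, up to a null set, in an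
        -- event about positions alone.
        refine measure_mono_ae ?_
        filter_upwards [hπ] with ω hω hbad s S hS hhits
        refine hbad ?_
        have h1 : M ≤ 2 * maxLoad (π ω) :=
          hS ▸ le_two_mul_maxLoad hk hω s S fun i hi => (hhits i).2 hi
        have h2 : (M : ℝ) ≤ 2 * maxLoad (π ω) := by exact_mod_cast h1
        have h3 := Nat.le_ceil (Real.log n / Real.log (Real.log n) / 4)
        linarith
    _ = ENNReal.ofReal (μ.real _) := (ofReal_measureReal).symm
    _ ≤ ENNReal.ofReal (1 / (n : ℝ) ^ (1 / 4 : ℝ)) :=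
        ENNReal.ofReal_le_ofReal (hmain.trans hbound)
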